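/- A real absolute-valued algebra is a real vector space $A$ with a bilinear product $A\times A\to A$, $(x,y)\mapsto xy$ (not assumed associative, commutative or unital), and a norm $\|\cdot\|$ such that $\|xy\|=\|x\|\,\|y\|$ for all $x,y\in A$. Write $(x,y,z)=(xy)z-x(yz)$ and $x^2=xx$. Let $\mathbb{H}$ be the algebra of real quaternions with its usual product and Euclidean norm, and let $\mathbb{H}^*$ be the normed space $\mathbb{H}$ with the product $x\odot y=x\overline{y}$, where $\overline{y}$ is the quaternion conjugate of $y$. **Theorem.** Let $A$ be a real absolute-valued algebra of dimension $4$. Then the following are equivalent: 1. $(x,x,x^2)=0$ for all $x\in A$; 2. $A$ is isomorphic, as a real algebra, to $\mathbb{H}$ or to $\mathbb{H}^*$. -/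

import Mathlib

open scoped Quaternion

/-- A real absolute-valued algebra: a real vector space with a bilinear product
(not assumed associative, commutative or unital) and a vector space norm such that
`‖x * y‖ = ‖x‖ * ‖y‖`. -/
class AbsoluteValuedAlgebra (A : Type*) extends NormedAddCommGroup A, NormedSpace ℝ A,
    NonUnitalNonAssocRing A where
  smul_mul' : ∀ (r : ℝ) (x y : A), (r • x) * y = r • (x * y)
  mul_smul' : ∀ (r : ℝ) (x y : A), x * (r • y) = r • (x * y)
  norm_mul' : ∀ x y : A, ‖x * y‖ = ‖x‖ * ‖y‖

/-- Isomorphism of (nonassociative) real algebras: a linear bijection preserving products. -/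
def AlgIsomorphic (A B : Type*) [NonUnitalNonAssocRing A] [Module ℝ A]
    [NonUnitalNonAssocRing B] [Module ℝ B] : Prop :=
  ∃ e : A ≃ₗ[ℝ] B, ∀ x y : A, e (x * y) = e x * e y

noncomputable section

/-- The quaternions, with the structure Mathlib gives them, are an absolute-valued algebra. -/
abbrev Quaternion.absoluteValuedAlgebra : AbsoluteValuedAlgebra ℍ[ℝ] where
  __ := (inferInstance : NormedAddCommGroup ℍ[ℝ])
  __ := (inferInstance : NormedSpace ℝ ℍ[ℝ])
  __ := (inferInstance : NonUnitalNonAssocRing ℍ[ℝ])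
  smul_mul' r x y := smul_mul_assoc r x y
  mul_smul' r x y := mul_smul_comm r x y
  norm_mul' x y := norm_mul x y

/-- The standard isotope `ℍ*`: a copy of the space of quaternions, with the same linear structure
and norm, but with the product `x ⊙ y = x * star y` (here `star` is quaternion conjugation). -/
def QuaternionStar : Type := ℍ[ℝ]

namespace QuaternionStar

instance : NormedAddCommGroup QuaternionStar := inferInstanceAs (NormedAddCommGroup ℍ[ℝ])

instance : NormedSpace ℝ QuaternionStar := inferInstanceAs (NormedSpace ℝ ℍ[ℝ])

/-- The identity map from the quaternions to the space underlying `ℍ*`. -/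
def ofQuaternion : ℍ[ℝ] ≃ₗ[ℝ] QuaternionStar := LinearEquiv.refl ℝ ℍ[ℝ]

instance : Mul QuaternionStar :=
  ⟨fun x y => ofQuaternion (ofQuaternion.symm x * star (ofQuaternion.symm y))⟩

theorem mul_def (x y : QuaternionStar) :
    x * y = ofQuaternion (ofQuaternion.symm x * star (ofQuaternion.symm y)) := rfl

theorem norm_ofQuaternion (q : ℍ[ℝ]) : ‖ofQuaternion q‖ = ‖q‖ := rfl

theorem norm_ofQuaternion_symm (x : QuaternionStar) : ‖ofQuaternion.symm x‖ = ‖x‖ := rfl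

instance : AbsoluteValuedAlgebra QuaternionStar where
  __ := (inferInstance : NormedAddCommGroup QuaternionStar)
  __ := (inferInstance : NormedSpace ℝ QuaternionStar)
  __ := (inferInstance : Mul QuaternionStar)
  left_distrib x y z := by simp [mul_def, mul_add]
  right_distrib x y z := by simp [mul_def, add_mul]
  zero_mul x := by simp [mul_def]
  mul_zero x := by simp [mul_def]
  smul_mul' r x y := by simp [mul_def]
  mul_smul' r x y := by simp [mul_def]
  norm_mul' x y := by simp [mul_def, norm_ofQuaternion, norm_ofQuaternion_symm]

end QuaternionStar

end

/-! Multiplications by unit vectors are isometries and act transitively on the unit sphere, so the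
norm of `A` is Euclidean (`parallelogram_of_transitive`). By Kaplansky's trick, undoing right and
left multiplication by a unit vector turns the product into a unital composition product, which in
dimension 4 is that of `ℍ`. Hence `A` is `ℍ` with product `F x * G y` for linear isometries `F`, `G`
(`exists_quaternion_isotope`).

By Cartan–Dieudonné each isometry is `p * x * q` or `p * star x * q`, and a change of variable
leaves four two-parameter families (`exists_quaternion_normal_form`). Testing the quartic identity
at `1`, at units `u` with `u * u = -1`, and at `1 + u` forces both parameters to be `±1` in two
families and is contradictory in the other two. The remaining sign is absorbed by `θ ↦ -θ`. -/

/-! ### Transitive norms are Euclidean -/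

open MeasureTheory Metric in
theorem LinearIsometryEquiv.measurePreserving_addHaar {V : Type*} [NormedAddCommGroup V]
    [NormedSpace ℝ V] [FiniteDimensional ℝ V] [MeasurableSpace V] [BorelSpace V]
    (μ : Measure V) [μ.IsAddHaarMeasure] (T : V ≃ₗᵢ[ℝ] V) : MeasurePreserving T μ μ := by
  refine ⟨T.continuous.measurable, ?_⟩
  have hdet : LinearMap.det (T.toLinearEquiv : V →ₗ[ℝ] V) ≠ 0 :=
    (LinearEquiv.isUnit_det' T.toLinearEquiv).ne_zero
  have h := Measure.map_linearMap_addHaar_eq_smul_addHaar μ hdet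
  have h' : μ.map T = ENNReal.ofReal |(LinearMap.det (T.toLinearEquiv : V →ₗ[ℝ] V))⁻¹| • μ := h
  -- The unit ball is fixed and has positive finite measure, so the scaling factor is 1.
  have hb : μ.map T (closedBall 0 1) = μ (closedBall 0 1) := by
    rw [Measure.map_apply T.continuous.measurable measurableSet_closedBall, T.preimage_closedBall,
      map_zero]
  rw [h', Measure.smul_apply, smul_eq_mul] at hb
  have hc := (ENNReal.mul_eq_right (measure_closedBall_pos μ 0 one_pos).ne'
    (measure_closedBall_lt_top (μ := μ)).ne).1 hb
  rw [h', hc, one_smul]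

open MeasureTheory Metric in
/-- A finite-dimensional normed space whose isometry group is transitive on the unit sphere
is Euclidean. -/
theorem parallelogram_of_transitive {V : Type*} [NormedAddCommGroup V] [NormedSpace ℝ V]
    [FiniteDimensional ℝ V]
    (h : ∀ x y : V, ‖x‖ = 1 → ‖y‖ = 1 → ∃ T : V ≃ₗᵢ[ℝ] V, T x = y) (x y : V) :
    ‖x + y‖ * ‖x + y‖ + ‖x - y‖ * ‖x - y‖ = 2 * (‖x‖ * ‖x‖ + ‖y‖ * ‖y‖) := by
  let μ : Measure (StrongDual ℝ V) := Measure.addHaar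
  let B : Set (StrongDual ℝ V) := closedBall 0 1
  -- An isometry-invariant quadratic form; transitivity makes it a multiple of the squared norm.
  let Q : V → ℝ := fun v => ∫ f in B, (f v) ^ 2 ∂μ
  have hcont (v : V) : Continuous fun f : StrongDual ℝ V => (f v) ^ 2 := by fun_prop
  have hint (v : V) : IntegrableOn (fun f : StrongDual ℝ V => (f v) ^ 2) B μ :=
    (hcont v).continuousOn.integrableOn_compact (isCompact_closedBall _ _)
  have hQT (T : V ≃ₗᵢ[ℝ] V) (v : V) : Q (T v) = Q v := by
    let S : StrongDual ℝ V ≃ₗᵢ[ℝ] StrongDual ℝ V :=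
      { (T.symm.toContinuousLinearEquiv.arrowCongr (.refl ℝ ℝ)).toLinearEquiv with
        norm_map' f := f.opNorm_comp_linearIsometryEquiv T }
    have hS (f : StrongDual ℝ V) (w : V) : S f w = f (T w) := rfl
    have hp := S.measurePreserving_addHaar μ
    have := hp.setIntegral_preimage_emb S.toHomeomorph.measurableEmbedding
      (fun f => (f v) ^ 2) B
    have hB : S ⁻¹' B = B := by
      rw [S.preimage_closedBall, map_zero]
    rw [hB] at this
    exact this
  have hQs (r : ℝ) (v : V) : Q (r • v) = r ^ 2 * Q v := by
    simp only [Q, map_smul, smul_eq_mul, mul_pow, integral_const_mul]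
  have hQp (v w : V) : Q (v + w) + Q (v - w) = 2 * (Q v + Q w) := by
    simp only [Q]
    rw [← integral_add (hint _) (hint _), ← integral_add (hint _) (hint _), ← integral_const_mul]
    refine integral_congr_ae (Filter.Eventually.of_forall fun f => ?_)
    simp only [map_add, map_sub]
    ring
  rcases subsingleton_or_nontrivial V with hV | hV
  · simp [Subsingleton.elim x 0, Subsingleton.elim y 0]
  obtain ⟨e, he⟩ := exists_norm_eq V zero_le_one
  have hQ (v : V) : Q v = ‖v‖ * ‖v‖ * Q e := by
    rcases eq_or_ne v 0 with rfl | hv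
    · simp [Q]
    · have hn : ‖v‖ ≠ 0 := norm_ne_zero_iff.2 hv
      obtain ⟨T, hT⟩ := h e (‖v‖⁻¹ • v) he (by rw [norm_smul, norm_inv, norm_norm, inv_mul_cancel₀ hn])
      have h1 := hQT T e
      rw [hT, hQs] at h1
      rw [← h1]
      field_simp
  -- Half a norming functional of `e` lies in the open ball, so the integrand is positive on a
  -- nonempty open set.
  have hpos : 0 < Q e := by
    obtain ⟨g, hg, hge⟩ := exists_dual_vector ℝ e (by rw [he]; exact one_ne_zero)
    refine (setIntegral_pos_iff_support_of_nonneg_ae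
      (Filter.Eventually.of_forall fun f => sq_nonneg _) (hint e)).2 ?_
    have hU : IsOpen (Function.support (fun f : StrongDual ℝ V => (f e) ^ 2) ∩ ball 0 1) :=
      (hcont e).isOpen_support.inter isOpen_ball
    refine (hU.measure_pos μ ⟨(2⁻¹ : ℝ) • g, ?_, ?_⟩).trans_le
      (measure_mono (Set.inter_subset_inter_right _ ball_subset_closedBall))
    · simp [hge, he]
    · simp [norm_smul, hg]
      norm_num
  have := hQp x y
  rw [hQ, hQ (x - y), hQ x, hQ y] at this
  nlinarith [mul_right_cancel₀ hpos.ne' (show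
    (‖x + y‖ * ‖x + y‖ + ‖x - y‖ * ‖x - y‖) * Q e = (2 * (‖x‖ * ‖x‖ + ‖y‖ * ‖y‖)) * Q e by linarith)]

/-! ### Unital composition products in dimension 4 -/

section CompositionAlgebra

open scoped RealInnerProductSpace

variable {V : Type*} [NormedAddCommGroup V] [InnerProductSpace ℝ V] (m : V →ₗ[ℝ] V →ₗ[ℝ] V)

/-- Polarisation of `‖m x y‖² = ‖x‖²‖y‖²` in both variables. -/
theorem inner_mul_add_inner_mul (hm : ∀ x y, ‖m x y‖ = ‖x‖ * ‖y‖) (x y z w : V) :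
    ⟪m x y, m w z⟫ + ⟪m x z, m w y⟫ = 2 * (⟪x, w⟫ * ⟪y, z⟫) := by
  have hs (x y : V) : ⟪m x y, m x y⟫ = ⟪x, x⟫ * ⟪y, y⟫ := by
    simp only [real_inner_self_eq_norm_sq, hm, mul_pow]
  have h1 := hs (x + w) (y + z)
  have h2 := hs (x + w) (y - z)
  have h3 := hs (x - w) (y + z)
  have h4 := hs (x - w) (y - z)
  simp only [map_add, map_sub, LinearMap.add_apply, LinearMap.sub_apply, inner_add_left,
    inner_add_right, inner_sub_left, inner_sub_right] at h1 h2 h3 h4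
  rw [real_inner_comm (m x y), real_inner_comm (m x z) (m w y)] at *
  simp only [real_inner_comm x w, real_inner_comm y z, real_inner_comm (m w z) (m x y),
    real_inner_comm (m w y) (m x z)] at *
  linarith

theorem inner_mul_mul_left (hm : ∀ x y, ‖m x y‖ = ‖x‖ * ‖y‖) (x y z : V) :
    ⟪m x y, m x z⟫ = ⟪x, x⟫ * ⟪y, z⟫ := by
  have := inner_mul_add_inner_mul m hm x y z x
  rw [real_inner_comm (m x y) (m x z)] at this
  linarith

/-- Polarising against the unit shows that `m x` is skew-adjoint; it is also a similarity of ratio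
`‖x‖`. -/
theorem mul_mul_of_inner_one_left {e : V} (hm : ∀ x y, ‖m x y‖ = ‖x‖ * ‖y‖)
    (h1 : ∀ x, m e x = x) {x : V} (hx : ⟪x, e⟫ = 0) (y : V) :
    m x (m x y) = -(⟪x, x⟫ • y) := by
  have hskew (y z : V) : ⟪m x y, z⟫ = -⟪m x z, y⟫ := by
    have := inner_mul_add_inner_mul m hm x y z e
    rw [h1, h1, hx] at this
    linarith
  refine ext_inner_right ℝ fun z => ?_
  rw [hskew, inner_mul_mul_left m hm, inner_neg_left, real_inner_smul_left, real_inner_comm y z]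

theorem mul_mul_anticomm_of_inner_one_left {e : V} (hm : ∀ x y, ‖m x y‖ = ‖x‖ * ‖y‖)
    (h1 : ∀ x, m e x = x) {x y : V} (hx : ⟪x, e⟫ = 0) (hy : ⟪y, e⟫ = 0) (hxy : ⟪x, y⟫ = 0)
    (z : V) : m x (m y z) = -m y (m x z) := by
  have h := mul_mul_of_inner_one_left m hm h1 (x := x + y)
    (by rw [inner_add_left, hx, hy, add_zero]) z
  simp only [map_add, LinearMap.add_apply, mul_mul_of_inner_one_left m hm h1 hx,
    mul_mul_of_inner_one_left m hm h1 hy, inner_add_left, inner_add_right, hxy,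
    real_inner_comm x y] at h
  rw [eq_neg_iff_add_eq_zero, ← sub_eq_zero.2 h]
  module

/-- With `e`, `i`, `j` orthonormal and `k = m i j`, the Clifford relations above yield Hamilton's
table without assuming associativity. -/
theorem exists_quaternion_linearIsometryEquiv (hV : Module.finrank ℝ V = 4) {e : V}
    (hm : ∀ x y, ‖m x y‖ = ‖x‖ * ‖y‖) (he : ‖e‖ = 1) (h1 : ∀ x, m e x = x)
    (h2 : ∀ x, m x e = x) :
    ∃ θ : ℍ[ℝ] ≃ₗᵢ[ℝ] V, ∀ x y, θ (x * y) = m (θ x) (θ y) := by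
  have : FiniteDimensional ℝ V := .of_finrank_pos (by omega)
  have exists_unit (s : Finset V) (hs : s.card < 4) : ∃ v : V, ‖v‖ = 1 ∧ ∀ w ∈ s, ⟪v, w⟫ = 0 := by
    have hlt : Module.finrank ℝ (Submodule.span ℝ (s : Set V)) < 4 :=
      (finrank_span_finset_le_card s).trans_lt hs
    have hne : (Submodule.span ℝ (s : Set V))ᗮ ≠ ⊥ := by
      intro h
      rw [Submodule.orthogonal_eq_bot_iff] at h
      rw [h, finrank_top, hV] at hlt
      exact lt_irrefl _ hlt
    obtain ⟨v, hv, hv0⟩ := Submodule.exists_mem_ne_zero_of_ne_bot hne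
    refine ⟨‖v‖⁻¹ • v, by rw [norm_smul, norm_inv, norm_norm,
      inv_mul_cancel₀ (norm_ne_zero_iff.2 hv0)], fun w hw => ?_⟩
    rw [inner_smul_left, Submodule.inner_left_of_mem_orthogonal (Submodule.subset_span hw) hv,
      mul_zero]
  classical
  obtain ⟨i, hi, hi'⟩ := exists_unit {e} (by simp)
  obtain ⟨j, hj, hj'⟩ := exists_unit {e, i} (Finset.card_le_two.trans_lt (by norm_num))
  have hie : ⟪i, e⟫ = 0 := hi' e (by simp)
  have hje : ⟪j, e⟫ = 0 := hj' e (by simp)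
  have hji : ⟪j, i⟫ = 0 := hj' i (by simp)
  set k := m i j with hk
  have hk1 : ‖k‖ = 1 := by rw [hk, hm, hi, hj, one_mul]
  have hii (y : V) : m i (m i y) = -y := by
    rw [mul_mul_of_inner_one_left m hm h1 hie, real_inner_self_eq_norm_sq, hi, one_pow, one_smul]
  have hjj (y : V) : m j (m j y) = -y := by
    rw [mul_mul_of_inner_one_left m hm h1 hje, real_inner_self_eq_norm_sq, hj, one_pow, one_smul]
  have hi2 : m i i = -e := by simpa [h2] using hii e
  have hj2 : m j j = -e := by simpa [h2] using hjj e
  have hki : ⟪k, i⟫ = 0 := by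
    have := inner_mul_mul_left m hm i j e
    rwa [h2, hje, mul_zero] at this
  have hke : ⟪k, e⟫ = 0 := by
    have := inner_mul_mul_left m hm i j i
    rw [hi2, hji, mul_zero, inner_neg_right] at this
    linarith
  have hkj : ⟪k, j⟫ = 0 := by
    have := inner_mul_add_inner_mul m hm i j j e
    rw [h1, hie] at this
    linarith
  have hkk (y : V) : m k (m k y) = -y := by
    rw [mul_mul_of_inner_one_left m hm h1 hke, real_inner_self_eq_norm_sq, hk1, one_pow, one_smul]
  have hk2 : m k k = -e := by simpa [h2] using hkk e
  have hjim : m j i = -k := by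
    have := mul_mul_anticomm_of_inner_one_left m hm h1 hje hie hji e
    rwa [h2, h2, ← hk] at this
  have hik : m i k = -j := hii j
  have hjk : m j k = i := by
    rw [← neg_neg k, ← hjim, map_neg, hjj, neg_neg]
  have hkim : m k i = j := by
    have := mul_mul_anticomm_of_inner_one_left m hm h1 hke hie hki e
    rwa [h2, h2, hik, neg_neg] at this
  have hkjm : m k j = -i := by
    have := mul_mul_anticomm_of_inner_one_left m hm h1 hke hje hkj e
    rwa [h2, h2, hjk] at this
  let f : ℍ[ℝ] →ₗ[ℝ] V :=
    { toFun q := q.re • e + q.imI • i + q.imJ • j + q.imK • k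
      map_add' p q := by simp only [Quaternion.re_add, Quaternion.imI_add, Quaternion.imJ_add,
          Quaternion.imK_add]; module
      map_smul' r q := by simp only [Quaternion.re_smul, Quaternion.imI_smul, Quaternion.imJ_smul,
          Quaternion.imK_smul, smul_eq_mul, RingHom.id_apply]; module }
  have hf (q : ℍ[ℝ]) : f q = q.re • e + q.imI • i + q.imJ • j + q.imK • k := rfl
  have hnorm (q : ℍ[ℝ]) : ‖f q‖ = ‖q‖ := by
    have : ‖f q‖ * ‖f q‖ = ‖q‖ * ‖q‖ := by
      rw [← Quaternion.normSq_eq_norm_mul_self, Quaternion.normSq_def',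
        ← real_inner_self_eq_norm_mul_norm, hf]
      have hei := real_inner_comm e i
      have hej := real_inner_comm e j
      have hek := real_inner_comm e k
      have hij := real_inner_comm i j
      have hik' := real_inner_comm i k
      have hjk' := real_inner_comm j k
      simp only [inner_smul_left, inner_smul_right, inner_add_left, inner_add_right,
          real_inner_self_eq_norm_sq, hi, hj, hk1, he, hie, hje, hke, hji, hki, hkj,
          ← hei, ← hej, ← hek, ← hij, ← hik', ← hjk',
          RCLike.conj_to_real]
      ring
    exact (mul_self_inj_of_nonneg (norm_nonneg _) (norm_nonneg _)).1 this
  let g : ℍ[ℝ] →ₗᵢ[ℝ] V := ⟨f, hnorm⟩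
  refine ⟨g.toLinearIsometryEquiv (by rw [hV, Quaternion.finrank_eq_four]), fun x y => ?_⟩
  change f (x * y) = m (f x) (f y)
  simp only [hf, Quaternion.re_mul, Quaternion.imI_mul, Quaternion.imJ_mul, Quaternion.imK_mul,
    map_add, map_smul, LinearMap.add_apply, LinearMap.smul_apply, h1, h2, hi2, hj2, hk2, hjim, hik,
    hjk, hkim, hkjm, ← hk]
  module

end CompositionAlgebra

/-! ### Reduction to isotopes of the quaternions -/

namespace AbsoluteValuedAlgebra

variable {A : Type*} [AbsoluteValuedAlgebra A]

/-- The product as a bilinear map. -/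
noncomputable def mulₗ (A : Type*) [AbsoluteValuedAlgebra A] : A →ₗ[ℝ] A →ₗ[ℝ] A :=
  LinearMap.mk₂ ℝ (· * ·) add_mul smul_mul' mul_add mul_smul'

theorem mulₗ_apply (x y : A) : mulₗ A x y = x * y := rfl

variable [FiniteDimensional ℝ A]

/-- Left multiplication by a unit vector as an isometry. -/
noncomputable def mulLeftIsometry (u : A) (hu : ‖u‖ = 1) : A ≃ₗᵢ[ℝ] A :=
  LinearIsometry.toLinearIsometryEquiv
    ⟨mulₗ A u, fun x => by rw [mulₗ_apply, norm_mul', hu, one_mul]⟩ rfl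

/-- Right multiplication by a unit vector as an isometry. -/
noncomputable def mulRightIsometry (u : A) (hu : ‖u‖ = 1) : A ≃ₗᵢ[ℝ] A :=
  LinearIsometry.toLinearIsometryEquiv
    ⟨(mulₗ A).flip u, fun x => by rw [LinearMap.flip_apply, mulₗ_apply, norm_mul', hu, mul_one]⟩ rfl

theorem mulLeftIsometry_apply (u : A) (hu : ‖u‖ = 1) (x : A) :
    mulLeftIsometry u hu x = u * x := rfl

theorem mulRightIsometry_apply (u : A) (hu : ‖u‖ = 1) (x : A) :
    mulRightIsometry u hu x = x * u := rfl

theorem parallelogram (x y : A) :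
    ‖x + y‖ * ‖x + y‖ + ‖x - y‖ * ‖x - y‖ = 2 * (‖x‖ * ‖x‖ + ‖y‖ * ‖y‖) := by
  refine parallelogram_of_transitive (fun v w hv hw => ?_) x y
  -- Solve `u * v = w` for `u`; left multiplication by `u` then carries `v` to `w`.
  have hu : ‖(mulRightIsometry v hv).symm w‖ = 1 := by rw [LinearIsometryEquiv.norm_map, hw]
  refine ⟨mulLeftIsometry _ hu, ?_⟩
  rw [mulLeftIsometry_apply, ← mulRightIsometry_apply v hv, LinearIsometryEquiv.apply_symm_apply]

theorem exists_quaternion_isotope (hA : Module.finrank ℝ A = 4) :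
    ∃ (θ : ℍ[ℝ] ≃ₗᵢ[ℝ] A) (F G : ℍ[ℝ] ≃ₗᵢ[ℝ] ℍ[ℝ]), ∀ x y, θ x * θ y = θ (F x * G y) := by
  let _ : InnerProductSpace ℝ A := InnerProductSpace.ofNorm ℝ parallelogram
  have : Nontrivial A := Module.nontrivial_of_finrank_pos (R := ℝ) (by omega)
  obtain ⟨e, he⟩ := exists_norm_eq A zero_le_one
  let R := mulRightIsometry e he
  let L := mulLeftIsometry e he
  -- Kaplansky's trick: this product has unit `e * e`.
  let m : A →ₗ[ℝ] A →ₗ[ℝ] A :=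
    (mulₗ A).compl₁₂ (R.symm.toLinearEquiv : A →ₗ[ℝ] A) (L.symm.toLinearEquiv : A →ₗ[ℝ] A)
  have hm (x y : A) : m x y = R.symm x * L.symm y := rfl
  have hR : R.symm (e * e) = e := R.symm_apply_apply e
  have hL : L.symm (e * e) = e := L.symm_apply_apply e
  obtain ⟨θ, hθ⟩ := exists_quaternion_linearIsometryEquiv m hA (e := e * e)
    (fun x y => by
      rw [hm, norm_mul', LinearIsometryEquiv.norm_map, LinearIsometryEquiv.norm_map])
    (by rw [norm_mul', he, one_mul])
    (fun x => by rw [hm, hR]; exact L.apply_symm_apply x)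
    (fun x => by rw [hm, hL]; exact R.apply_symm_apply x)
  refine ⟨θ, (θ.trans R).trans θ.symm, (θ.trans L).trans θ.symm, fun x y => ?_⟩
  simp [hθ, hm]

end AbsoluteValuedAlgebra

/-! ### Linear isometries of the quaternions -/

namespace Quaternion

theorem mul_star_of_norm_eq_one {q : ℍ[ℝ]} (hq : ‖q‖ = 1) : q * star q = 1 := by
  rw [self_mul_star, normSq_eq_norm_mul_self, hq]
  simp

theorem star_mul_of_norm_eq_one {q : ℍ[ℝ]} (hq : ‖q‖ = 1) : star q * q = 1 := by
  rw [star_mul_self, normSq_eq_norm_mul_self, hq]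
  simp

theorem reflection_orthogonal_singleton_of_norm_eq_one {u : ℍ[ℝ]} (hu : ‖u‖ = 1) (x : ℍ[ℝ]) :
    (ℝ ∙ u)ᗮ.reflection x = -(u * star x * u) := by
  have h1 := normSq_eq_norm_mul_self u
  rw [hu, normSq_def'] at h1
  rw [Submodule.reflection_orthogonal_apply, Submodule.reflection_singleton_apply, hu, neg_inj,
    real_inner_comm, inner_def, RCLike.ofReal_one, one_pow, div_one, two_smul]
  ext <;> simp
  · linear_combination x.re * h1
  · linear_combination x.imI * h1
  · linear_combination x.imJ * h1
  · linear_combination x.imK * h1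

theorem reflection_orthogonal_singleton (v : ℍ[ℝ]) :
    (∃ u : ℍ[ℝ], ‖u‖ = 1 ∧ ∀ x, (ℝ ∙ v)ᗮ.reflection x = -(u * star x * u)) ∨
      ∀ x, (ℝ ∙ v)ᗮ.reflection x = x := by
  rcases eq_or_ne v 0 with rfl | hv
  · refine .inr fun x => Submodule.reflection_mem_subspace_eq_self ?_
    simp
  · have hn : ‖v‖ ≠ 0 := norm_ne_zero_iff.2 hv
    have hu : ‖‖v‖⁻¹ • v‖ = 1 := by rw [norm_smul, norm_inv, norm_norm, inv_mul_cancel₀ hn]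
    have hspan : (ℝ ∙ ‖v‖⁻¹ • v) = ℝ ∙ v :=
      Submodule.span_singleton_smul_eq (IsUnit.mk0 _ (inv_ne_zero hn)) v
    refine .inl ⟨‖v‖⁻¹ • v, hu, fun x => ?_⟩
    rw [← reflection_orthogonal_singleton_of_norm_eq_one hu]
    congr! 3
    exact hspan.symm

/-- `F` is a product of reflections, and each nontrivial one, `x ↦ -(u * star x * u)`, swaps the two
forms. -/
theorem linearIsometryEquiv_eq (F : ℍ[ℝ] ≃ₗᵢ[ℝ] ℍ[ℝ]) :
    ∃ p q : ℍ[ℝ], ‖p‖ = 1 ∧ ‖q‖ = 1 ∧ ((∀ x, F x = p * x * q) ∨ ∀ x, F x = p * star x * q) := by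
  obtain ⟨l, -, rfl⟩ := F.reflections_generate_dim
  induction l with
  | nil => exact ⟨1, 1, by simp, by simp, .inl fun x => by simp⟩
  | cons v l ih =>
    obtain ⟨p, q, hp, hq, h⟩ := ih
    obtain ⟨u, hu, hr⟩ | hr := reflection_orthogonal_singleton v
    · refine ⟨-(u * star q), star p * u, by simp [hu, hq], by simp [hu, hp], ?_⟩
      rcases h with h | h
      · refine .inr fun x => ?_
        simp [h, hr, mul_assoc]
      · refine .inl fun x => ?_
        simp [h, hr, mul_assoc]
    · refine ⟨p, q, hp, hq, ?_⟩
      simpa [hr] using h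


/-! ### The quartic identity in the four families -/

theorem star_eq_neg_of_re_eq_zero {u : ℍ[ℝ]} (h : u.re = 0) : star u = -u := by
  ext <;> simp [h]

theorem mul_self_eq_neg_one {u : ℍ[ℝ]} (h : u.re = 0)
    (h1 : u.imI ^ 2 + u.imJ ^ 2 + u.imK ^ 2 = 1) : u * u = -1 := by
  ext <;> simp [h]
  · linear_combination -h1
  all_goals ring

theorem exists_pure_unit {r s t : ℝ} (h : r ^ 2 + s ^ 2 + t ^ 2 = 1) :
    ∃ u : ℍ[ℝ], star u = -u ∧ u * u = -1 ∧ u.re = 0 ∧ u.imI = r ∧ u.imJ = s ∧ u.imK = t := by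
  obtain ⟨u, h0, h1, h2, h3⟩ :
      ∃ u : ℍ[ℝ], u.re = 0 ∧ u.imI = r ∧ u.imJ = s ∧ u.imK = t :=
    ⟨⟨0, r, s, t⟩, rfl, rfl, rfl, rfl⟩
  exact ⟨u, star_eq_neg_of_re_eq_zero h0, mul_self_eq_neg_one h0 (by rw [h1, h2, h3, h]),
    h0, h1, h2, h3⟩

theorem eq_one_or_eq_neg_one_of_commute {a : ℍ[ℝ]} (ha : ‖a‖ = 1)
    (h : ∀ u : ℍ[ℝ], star u = -u → u * u = -1 → a * u = u * a) : a = 1 ∨ a = -1 := by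
  have h1 := normSq_eq_norm_mul_self a
  rw [ha, normSq_def'] at h1
  obtain ⟨i, hi, hi', i0, i1, i2, i3⟩ := exists_pure_unit (r := 1) (s := 0) (t := 0) (by norm_num)
  obtain ⟨j, hj, hj', j0, j1, j2, j3⟩ := exists_pure_unit (r := 0) (s := 1) (t := 0) (by norm_num)
  have hK : a.imK = 0 := by
    have := congrArg QuaternionAlgebra.imJ (h i hi hi')
    rw [imJ_mul, imJ_mul, i0, i1, i2, i3] at this
    linarith
  have hJ : a.imJ = 0 := by
    have := congrArg QuaternionAlgebra.imK (h i hi hi')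
    rw [imK_mul, imK_mul, i0, i1, i2, i3] at this
    linarith
  have hI : a.imI = 0 := by
    have := congrArg QuaternionAlgebra.imK (h j hj hj')
    rw [imK_mul, imK_mul, j0, j1, j2, j3] at this
    linarith
  have hre : a.re ^ 2 = 1 := by simpa [hI, hJ, hK] using h1
  rcases mul_self_eq_one_iff.1 ((sq _).symm.trans hre) with h | h
  · left; ext <;> simp [*]
  · right; ext <;> simp [*]

theorem exists_commute_mul_self_eq_neg_one (b : ℍ[ℝ]) :
    ∃ u : ℍ[ℝ], star u = -u ∧ u * u = -1 ∧ u * b = b * u := by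
  by_cases hb : b.im = 0
  · obtain ⟨u, hu, hu', -⟩ := exists_pure_unit (r := 1) (s := 0) (t := 0) (by norm_num)
    have hb' : b = (b.re : ℍ[ℝ]) := by
      conv_lhs => rw [← re_add_im b, hb, add_zero]
    exact ⟨u, hu, hu', by rw [hb', coe_commutes]⟩
  · have hn : ‖b.im‖ ≠ 0 := norm_ne_zero_iff.2 hb
    have hre : (‖b.im‖⁻¹ • b.im).re = 0 := by simp
    refine ⟨‖b.im‖⁻¹ • b.im, star_eq_neg_of_re_eq_zero hre, mul_self_eq_neg_one hre ?_, ?_⟩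
    · have h1 := normSq_eq_norm_mul_self (‖b.im‖⁻¹ • b.im)
      rw [norm_smul, norm_inv, norm_norm, inv_mul_cancel₀ hn, normSq_def', hre] at h1
      linarith
    · rw [smul_mul_assoc, mul_smul_comm]
      congr 1
      conv_lhs => rw [← re_add_im b]
      conv_rhs => rw [← re_add_im b]
      rw [im_add, im_coe, im_idem, zero_add, mul_add, add_mul, coe_commutes]


theorem eq_zero_of_eq_neg {x : ℍ[ℝ]} (h : x = -x) : x = 0 := by
  rw [eq_neg_iff_add_eq_zero, ← two_smul ℝ] at h
  simpa using h

theorem mul_mul_mul_eq_of_fourth_power_identity {a c : ℍ[ℝ]} (ha : ‖a‖ = 1) (hc : ‖c‖ = 1)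
    (H : ∀ x, a * (a * x * x * c) * (a * x * x * c) * c =
      a * x * (a * x * (a * x * x * c) * c) * c) : (a = 1 ∨ a = -1) ∧ (c = 1 ∨ c = -1) := by
  have ha0 : a ≠ 0 := norm_ne_zero_iff.1 (by rw [ha]; exact one_ne_zero)
  have hc0 : c ≠ 0 := norm_ne_zero_iff.1 (by rw [hc]; exact one_ne_zero)
  have E (x) : a * (x * x) * c * a * (x * x) = x * a * x * a * (x * x) * c :=
    mul_left_cancel₀ ha0 <| mul_right_cancel₀ hc0 <| mul_right_cancel₀ hc0 <| by
      simpa only [mul_assoc] using H x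
  have hca : c * a = a * c := mul_left_cancel₀ ha0 <| by simpa [mul_assoc] using E 1
  have ha1 : a = 1 ∨ a = -1 := eq_one_or_eq_neg_one_of_commute ha fun u _ hu => by
    have h := E u
    rw [hu, mul_assoc _ c, hca] at h
    have h2 : a = -(u * a * u) :=
      mul_right_cancel₀ ha0 <| mul_right_cancel₀ hc0 <| by simpa [mul_assoc] using h
    calc a * u = -(u * a * (u * u)) := by
          conv_lhs => rw [h2]
          simp [mul_assoc]
      _ = u * a := by rw [hu]; simp
  have E' (x) : x * x * c * (x * x) = x * x * (x * x) * c := by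
    have := E x
    rcases ha1 with rfl | rfl <;>
      simpa only [one_mul, mul_one, neg_mul, mul_neg, neg_neg, mul_assoc] using this
  -- Units `u` only give `u * u = -1`, which says nothing about `c`; but `(1 + u)² = 2u`.
  refine ⟨ha1, eq_one_or_eq_neg_one_of_commute hc fun u _ hu => ?_⟩
  have hE : (1 + u) * (1 + u) * (c * ((1 + u) * (1 + u))) =
      (1 + u) * (1 + u) * ((1 + u) * (1 + u) * c) := by
    simpa only [mul_assoc] using E' (1 + u)
  have h2u : (1 + u) * (1 + u) = (2 : ℝ) • u := by
    simp only [mul_add, add_mul, hu, mul_one, one_mul]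
    module
  have hu0 : (2 : ℝ) • u ≠ 0 := by
    simp only [ne_eq, smul_eq_zero, not_or]
    exact ⟨two_ne_zero, by rintro rfl; simp at hu⟩
  rw [h2u] at hE
  have := mul_left_cancel₀ hu0 hE
  rw [mul_smul_comm, smul_mul_assoc] at this
  exact smul_right_injective _ (two_ne_zero (α := ℝ)) this

theorem mul_mul_mul_star_eq_of_fourth_power_identity {a b : ℍ[ℝ]} (ha : ‖a‖ = 1) (hb : ‖b‖ = 1)
    (H : ∀ x, a * (a * x * b * star x) * b * star (a * x * b * star x) =
      a * x * b * star (a * x * b * star (a * x * b * star x))) :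
    (a = 1 ∨ a = -1) ∧ (b = 1 ∨ b = -1) := by
  have ha0 : a ≠ 0 := norm_ne_zero_iff.1 (by rw [ha]; exact one_ne_zero)
  have hb0 : b ≠ 0 := norm_ne_zero_iff.1 (by rw [hb]; exact one_ne_zero)
  have E (x) (hx : x ≠ 0) : a * x * b * star x * b * x = x * b * a * x * b * star x :=
    mul_left_cancel₀ ha0 <| mul_right_cancel₀ (star_ne_zero.2 hb0) <|
      mul_right_cancel₀ (star_ne_zero.2 hx) <| mul_right_cancel₀ (star_ne_zero.2 ha0) <| by
      simpa [mul_assoc] using H x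
  have hab : b * a = a * b := mul_right_cancel₀ hb0 <| by
    simpa [mul_assoc] using (E 1 one_ne_zero).symm
  have hne {u : ℍ[ℝ]} (hu : u * u = -1) : u ≠ 0 := by rintro rfl; simp at hu
  have ha1 : a = 1 ∨ a = -1 := eq_one_or_eq_neg_one_of_commute ha fun u hs hu => by
    have h := E u (hne hu)
    rw [hs, mul_assoc u b a, hab] at h
    exact mul_right_cancel₀ hb0 <| mul_right_cancel₀ (hne hu) <| mul_right_cancel₀ hb0 <|
      mul_right_cancel₀ (hne hu) <| by simpa [mul_assoc] using h
  have E' (x) (hx : x ≠ 0) : star x * b * x = x * b * star x :=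
    mul_left_cancel₀ hb0 <| mul_left_cancel₀ hx <| by
    have := E x hx
    rcases ha1 with rfl | rfl <;>
      simpa only [one_mul, mul_one, neg_mul, mul_neg, neg_neg, neg_inj, mul_assoc] using this
  refine ⟨ha1, eq_one_or_eq_neg_one_of_commute hb fun u hs hu => ?_⟩
  have hn : 1 + u ≠ 0 := by
    intro h
    obtain rfl : u = -1 := (neg_eq_of_add_eq_zero_right h).symm
    rw [star_neg, star_one] at hs
    exact neg_ne_zero.2 one_ne_zero (eq_zero_of_eq_neg hs)
  have hE := E' (1 + u) hn
  simp only [star_add, star_one, hs, mul_add, add_mul, one_mul, mul_one, neg_mul, mul_neg] at hE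
  have h2 : (2 : ℝ) • (b * u) = (2 : ℝ) • (u * b) := by
    rw [← sub_eq_zero] at hE ⊢
    rw [← hE]
    module
  exact smul_right_injective _ (two_ne_zero (α := ℝ)) h2

/-- Passing from `x = 1` to an imaginary unit commuting with `b` negates just one side of `E`. -/
theorem not_fourth_power_identity_star_mul {b c : ℍ[ℝ]} (hb : ‖b‖ = 1) (hc : ‖c‖ = 1)
    (H : ∀ x, star (star x * b * x * c) * b * (star x * b * x * c) * c =
      star x * b * (star x * b * (star x * b * x * c) * c) * c) : False := by
  have hb0 : b ≠ 0 := norm_ne_zero_iff.1 (by rw [hb]; exact one_ne_zero)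
  have hc0 : c ≠ 0 := norm_ne_zero_iff.1 (by rw [hc]; exact one_ne_zero)
  have E (x) : star c * star x * star b * x * b * star x * b * x =
      star x * b * star x * b * star x * b * x * c :=
    mul_right_cancel₀ hc0 <| mul_right_cancel₀ hc0 <| by simpa [mul_assoc] using H x
  have h1 : star c * star b * b * b = b * b * b * c := by simpa [mul_assoc] using E 1
  obtain ⟨u, hs, hu, hub⟩ := exists_commute_mul_self_eq_neg_one b
  have h := E u
  have hcomm : Commute u b := hub
  have hcomm' : Commute u (star b) := by
    have := hcomm.star_star
    rwa [hs, Commute.neg_left_iff] at this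
  have hL : star c * star u * star b * u * b * star u * b * u = star c * star b * b * b := by
    calc _ = star c * (u * star b) * u * b * (u * b) * u := by rw [hs]; noncomm_ring
      _ = star c * (star b * u) * u * b * (b * u) * u := by rw [hcomm.eq, hcomm'.eq]
      _ = star c * star b * (u * u) * b * b * (u * u) := by noncomm_ring
      _ = _ := by rw [hu]; noncomm_ring
  have hR : star u * b * star u * b * star u * b * u * c = -(b * b * b * c) := by
    calc _ = -((u * b) * (u * b) * (u * b) * u * c) := by rw [hs]; noncomm_ring
      _ = -((b * u) * (u * b) * (b * u) * u * c) := by rw [hcomm.eq]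
      _ = -(b * (u * u) * b * b * (u * u) * c) := by noncomm_ring
      _ = _ := by rw [hu]; noncomm_ring
  rw [hL, hR, h1] at h
  simpa [hb0, hc0] using eq_zero_of_eq_neg h

/-- The identity gives `e = u * e * u` for all imaginary units `u`, which kills the real part of `e`
and its component along `u`; yet `e` is a product of units. -/
theorem not_fourth_power_identity_star_mul_star {a c : ℍ[ℝ]} (ha : ‖a‖ = 1) (hc : ‖c‖ = 1)
    (H : ∀ x, a * star (a * star x * star x * c) * star (a * star x * star x * c) * c =
      a * star x * star (a * star x * star (a * star x * star x * c) * c) * c) : False := by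
  have ha0 : a ≠ 0 := norm_ne_zero_iff.1 (by rw [ha]; exact one_ne_zero)
  have hc0 : c ≠ 0 := norm_ne_zero_iff.1 (by rw [hc]; exact one_ne_zero)
  have E (x) : star c * x * x * star a * star c * x * x =
      star x * star c * a * star x * star x * c * x :=
    mul_left_cancel₀ ha0 <| mul_right_cancel₀ (star_ne_zero.2 ha0) <| mul_right_cancel₀ hc0 <| by
      simpa [mul_assoc] using H x
  set e := star c * a * c with he
  have h1 : star c * star a * star c = e := by
    simpa only [star_one, mul_one, one_mul] using E 1
  have hu {u : ℍ[ℝ]} (hs : star u = -u) (hu : u * u = -1) : e = u * e * u := by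
    calc e = star c * (u * u) * star a * star c * (u * u) := by rw [hu, ← h1]; noncomm_ring
      _ = star u * star c * a * (star u * star u) * c * u := by
        rw [← mul_assoc, ← mul_assoc, E, ← mul_assoc]
      _ = u * e * u := by rw [hs, neg_mul_neg, hu, he]; noncomm_ring
  obtain ⟨i, hi, hi', i0, i1, i2, i3⟩ := exists_pure_unit (r := 1) (s := 0) (t := 0) (by norm_num)
  obtain ⟨j, hj, hj', j0, j1, j2, j3⟩ := exists_pure_unit (r := 0) (s := 1) (t := 0) (by norm_num)
  obtain ⟨k, hk, hk', k0, k1, k2, k3⟩ := exists_pure_unit (r := 0) (s := 0) (t := 1) (by norm_num)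
  have hi := Quaternion.ext_iff.1 (hu hi hi')
  have hj := Quaternion.ext_iff.1 (hu hj hj')
  have hk := Quaternion.ext_iff.1 (hu hk hk')
  simp only [re_mul, imI_mul, imJ_mul, imK_mul, i0, i1, i2, i3, j0, j1, j2, j3, k0, k1, k2, k3]
    at hi hj hk
  have he0 : e = 0 := by
    refine Quaternion.ext _ _ ?_ ?_ ?_ ?_
    · exact (by linarith [hi.1] : e.re = 0)
    · exact (by linarith [hi.2.1] : e.imI = 0)
    · exact (by linarith [hj.2.2.1] : e.imJ = 0)
    · exact (by linarith [hk.2.2.2] : e.imK = 0)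
  simp [he, ha0, hc0] at he0


theorem exists_linearEquiv_mul_right {b : ℍ[ℝ]} (hb : ‖b‖ = 1) :
    ∃ φ : ℍ[ℝ] ≃ₗ[ℝ] ℍ[ℝ], ∀ x, φ x = x * b :=
  ⟨.ofLinearMap (LinearMap.mulRight ℝ b) (LinearMap.mulRight ℝ (star b))
    (by ext1 x; simp [mul_assoc, star_mul_of_norm_eq_one hb])
    (by ext1 x; simp [mul_assoc, mul_star_of_norm_eq_one hb]), fun _ => rfl⟩

theorem exists_linearEquiv_mul_left {b : ℍ[ℝ]} (hb : ‖b‖ = 1) :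
    ∃ φ : ℍ[ℝ] ≃ₗ[ℝ] ℍ[ℝ], ∀ x, φ x = b * x :=
  ⟨.ofLinearMap (LinearMap.mulLeft ℝ b) (LinearMap.mulLeft ℝ (star b))
    (by ext1 x; simp [← mul_assoc, mul_star_of_norm_eq_one hb])
    (by ext1 x; simp [← mul_assoc, star_mul_of_norm_eq_one hb]), fun _ => rfl⟩

end Quaternion

/-! ### Normal forms and the classification -/

namespace AbsoluteValuedAlgebra

open Quaternion

variable {A : Type*} [AbsoluteValuedAlgebra A]

theorem exists_quaternion_normal_form (hA : Module.finrank ℝ A = 4) :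
    ∃ (θ : ℍ[ℝ] ≃ₗ[ℝ] A) (a b : ℍ[ℝ]), ‖a‖ = 1 ∧ ‖b‖ = 1 ∧
      ((∀ x y, θ x * θ y = θ (a * x * y * b)) ∨ (∀ x y, θ x * θ y = θ (a * x * b * star y)) ∨
        (∀ x y, θ x * θ y = θ (star x * a * y * b)) ∨
        ∀ x y, θ x * θ y = θ (a * star x * star y * b)) := by
  have : FiniteDimensional ℝ A := .of_finrank_pos (by omega)
  obtain ⟨θ, F, G, h⟩ := exists_quaternion_isotope hA
  obtain ⟨p, q, hp, hq, hF⟩ := linearIsometryEquiv_eq F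
  obtain ⟨r, s, hr, hs, hG⟩ := linearIsometryEquiv_eq G
  have hqr : ‖q * r‖ = 1 := by rw [norm_mul, hq, hr, one_mul]
  have cancel {u : ℍ[ℝ]} (hu : ‖u‖ = 1) (z : ℍ[ℝ]) : u * (star u * z) = z := by
    rw [← mul_assoc, mul_star_of_norm_eq_one hu, one_mul]
  have cancel' {u : ℍ[ℝ]} (hu : ‖u‖ = 1) (z : ℍ[ℝ]) : star u * (u * z) = z := by
    rw [← mul_assoc, star_mul_of_norm_eq_one hu, one_mul]
  have key (φ : ℍ[ℝ] ≃ₗ[ℝ] ℍ[ℝ]) (N : ℍ[ℝ] → ℍ[ℝ] → ℍ[ℝ])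
      (hN : ∀ x y, F (φ x) * G (φ y) = φ (N x y)) (x y : ℍ[ℝ]) :
      φ.trans θ.toLinearEquiv x * φ.trans θ.toLinearEquiv y = φ.trans θ.toLinearEquiv (N x y) :=
    (h _ _).trans (congrArg θ (hN x y))
  -- In each case `φ` is multiplication by a unit chosen to cancel one of the factors `p`, `q * r`,
  -- `s`.
  rcases hF with hF | hF <;> rcases hG with hG | hG
  · obtain ⟨φ, hφ⟩ := exists_linearEquiv_mul_right (b := star (q * r)) (by rw [norm_star, hqr])
    refine ⟨φ.trans θ.toLinearEquiv, p, star (q * r) * s * (q * r), hp, by simp [hq, hr, hs],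
      .inl <| key φ _ fun x y => ?_⟩
    simp [hφ, hF, hG, mul_assoc, cancel' hq, cancel hr, cancel' hr,
      mul_star_of_norm_eq_one hq]
  · obtain ⟨φ, hφ⟩ := exists_linearEquiv_mul_left hs
    refine ⟨φ.trans θ.toLinearEquiv, star s * p * s, q * r, by simp [hp, hs], hqr,
      .inr <| .inl <| key φ _ fun x y => ?_⟩
    simp [hφ, hF, hG, mul_assoc, cancel hs, star_mul_of_norm_eq_one hs]
  · obtain ⟨φ, hφ⟩ := exists_linearEquiv_mul_right hp
    refine ⟨φ.trans θ.toLinearEquiv, q * r, p * s * star p, hqr, by simp [hp, hs],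
      .inr <| .inr <| .inl <| key φ _ fun x y => ?_⟩
    simp [hφ, hF, hG, mul_assoc, cancel hp, star_mul_of_norm_eq_one hp]
  · obtain ⟨φ, hφ⟩ := exists_linearEquiv_mul_right hqr
    refine ⟨φ.trans θ.toLinearEquiv, p * star (q * r), s * star (q * r), by simp [hp, hq, hr],
      by simp [hq, hr, hs], .inr <| .inr <| .inr <| key φ _ fun x y => ?_⟩
    simp [hφ, hF, hG, mul_assoc, cancel hq, cancel hr, cancel' hq,
      star_mul_of_norm_eq_one hr]

theorem exists_linearEquiv_of_signs {B : ℍ[ℝ] → ℍ[ℝ] → ℍ[ℝ]} (θ : ℍ[ℝ] ≃ₗ[ℝ] A)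
    (h : (∀ x y, θ x * θ y = θ (B x y)) ∨ ∀ x y, θ x * θ y = -θ (B x y)) :
    ∃ θ' : ℍ[ℝ] ≃ₗ[ℝ] A, ∀ x y, θ' x * θ' y = θ' (B x y) := by
  rcases h with h | h
  · exact ⟨θ, h⟩
  · exact ⟨θ.trans (LinearEquiv.neg ℝ), fun x y => by simp [h]⟩

theorem algIsomorphic_quaternion_or_quaternionStar (hA : Module.finrank ℝ A = 4)
    (H : ∀ x : A, x * x * (x * x) = x * (x * (x * x))) :
    AlgIsomorphic A ℍ[ℝ] ∨ AlgIsomorphic A QuaternionStar := by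
  obtain ⟨θ, a, b, ha, hb, h⟩ := exists_quaternion_normal_form hA
  have transfer {N : ℍ[ℝ] → ℍ[ℝ] → ℍ[ℝ]} (hN : ∀ x y, θ x * θ y = θ (N x y)) (x : ℍ[ℝ]) :
      N (N x x) (N x x) = N x (N x (N x x)) :=
    θ.injective <| by simpa only [hN] using H (θ x)
  rcases h with h | h | h | h
  · left
    obtain ⟨θ', hθ⟩ := exists_linearEquiv_of_signs (B := fun x y => x * y) θ <| by
      obtain ⟨rfl | rfl, rfl | rfl⟩ := mul_mul_mul_eq_of_fourth_power_identity ha hb (transfer h)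
      all_goals simp [h]
    refine ⟨θ'.symm, fun x y => ?_⟩
    rw [LinearEquiv.symm_apply_eq, ← hθ, θ'.apply_symm_apply, θ'.apply_symm_apply]
  · right
    obtain ⟨θ', hθ⟩ := exists_linearEquiv_of_signs (B := fun x y => x * star y) θ <| by
      obtain ⟨rfl | rfl, rfl | rfl⟩ :=
        mul_mul_mul_star_eq_of_fourth_power_identity ha hb (transfer h)
      all_goals simp [h]
    refine ⟨θ'.symm.trans QuaternionStar.ofQuaternion, fun x y => ?_⟩
    simp only [LinearEquiv.trans_apply, QuaternionStar.mul_def, LinearEquiv.symm_apply_apply]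
    rw [EmbeddingLike.apply_eq_iff_eq, LinearEquiv.symm_apply_eq, ← hθ, θ'.apply_symm_apply,
      θ'.apply_symm_apply]
  · exact (not_fourth_power_identity_star_mul ha hb (transfer h)).elim
  · exact (not_fourth_power_identity_star_mul_star ha hb (transfer h)).elim

end AbsoluteValuedAlgebra

/-- Both sides are words in `q` and `star q`, which commute. -/
theorem QuaternionStar.mul_self_mul_mul_self (x : QuaternionStar) :
    x * x * (x * x) = x * (x * (x * x)) := by
  set q := QuaternionStar.ofQuaternion.symm x
  have hn : q * star q = star q * q :=
    (Quaternion.self_mul_star q).trans (Quaternion.star_mul_self q).symm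
  simp only [mul_def, LinearEquiv.symm_apply_apply, star_mul, star_star,
    EmbeddingLike.apply_eq_iff_eq]
  change q * star q * (q * star q) = q * (q * star q * star q)
  rw [mul_assoc q (star q) (q * star q), ← mul_assoc (star q), ← hn]

theorem theorem3p13 (A : Type*) [AbsoluteValuedAlgebra A] (hA : Module.finrank ℝ A = 4) :
    (∀ x : A, associator x x (x * x) = 0) ↔
      AlgIsomorphic A ℍ[ℝ] ∨ AlgIsomorphic A QuaternionStar := by
  simp only [associator_apply, sub_eq_zero]
  refine ⟨AbsoluteValuedAlgebra.algIsomorphic_quaternion_or_quaternionStar hA, ?_⟩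
  rintro (⟨e, he⟩ | ⟨e, he⟩) x <;> apply e.injective <;> simp only [he]
  · exact mul_assoc _ _ _
  · exact QuaternionStar.mul_self_mul_mul_self _
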